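/- **Theorem.** Let $\mathcal C$ be a category with finite limits and let $P:\mathcal C^{op}\to \mathsf{InfSl}$ be a lex primary doctrine, i.e. a functor to the category of inf-semilattices (with top element; homomorphisms preserve binary meets and top); write $P_f$ for $P(f)$. Then there is an equivalence of categories $$\mathsf{Reg}(P^{\exists})\;\simeq\;(\mathcal G_P)_{\mathrm{reg/lex}},$$ where the following notation is used. *Category of points.* $\mathcal G_P$ has as objects the pairs $(A,\alpha)$ with $A\in\mathcal C$ and $\alpha\in P(A)$, and as morphisms $(A,\alpha)\to(B,\beta)$ the arrows $f:A\to B$ of $\mathcal C$ with $\alpha\le P_f(\beta)$. It has finite limits. *Full existential completion.* $P^{\exists}(A)$ is the poset reflection of the preorder of pairs $(f:B\to A,\ \alpha\in P(B))$, where $(f:B\to A,\alpha)\le(g:D\to A,\beta)$ if there is $h:B\to D$ with $f=g h$ and $\alpha\le P_h(\beta)$; for $f:A\to B$, the map $P^\exists_f$ sends the class of $(g:D\to B,\beta)$ to the class of $(f^*g,\,P_{g^*f}(\beta))$, where $f^*g:A\times_B D\to A$ and $g^*f:A\times_B D\to D$ are the pullback projections. $P^\exists$ is a full existential doctrine: every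 $P^\exists_f$ has a left adjoint $\exists_f$ (given by postcomposition with $f$), and these satisfy the Beck–Chevalley condition and Frobenius reciprocity. *Regular completion of a full existential doctrine $R$ on $\mathcal C$.* The objects of $\mathsf{Reg}(R)$ are the pairs $(A,\alpha)$ with $\alpha\in R(A)$. An arrow $(A,\alpha)\to(B,\beta)$ is an element $\phi\in R(A\times B)$ such that $\phi\le R_{\pi_A}(\alpha)\wedge R_{\pi_B}(\beta)$, $\alpha\le\exists_{\pi_A}(\phi)$, and $R_{\langle\pi_1,\pi_2\rangle}(\phi)\wedge R_{\langle\pi_1,\pi_3\rangle}(\phi)\le R_{\langle\pi_2,\pi_3\rangle}(\delta_B)$ in $R(A\times B\times B)$, where $\delta_B=\exists_{\langle \mathrm{id},\mathrm{id}\rangle}(\top)$. The composite of $\phi:(A,\alpha)\to(B,\beta)$ and $\psi:(B,\beta)\to(D,\gamma)$ is $\exists_{\langle\pi_1,\pi_3\rangle}\bigl(R_{\langle\pi_1,\pi_2\rangle}(\phi)\wedge R_{\langle\pi_2,\pi_3\rangle}(\psi)\bigr)$, with $\pi_i$ the projections from $A\times B\times D$; the identity on $(A,\alpha)$ is $R_{\pi_1}(\alpha)\wedge\delta_A$.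 *Reg/lex completion of a category $\mathcal D$ with finite limits.* The objects of $\mathcal D_{\mathrm{reg/lex}}$ are the arrows $f:X\to Y$ of $\mathcal D$. An arrow from $f:X\to Y$ to $g:Z\to W$ is an equivalence class $[l]$ of arrows $l:X\to Z$ of $\mathcal D$ with $g\,l\,f_0=g\,l\,f_1$, where $f_0,f_1$ is the kernel pair of $f$, and $[l]=[m]$ if and only if $g\,l=g\,m$; composition and identities are those of $\mathcal D$. -/

import Mathlib

open CategoryTheory CategoryTheory.Limits Opposite

universe w v u

noncomputable section

attribute [local simp] prod.lift_fst prod.lift_snd prod.lift_fst_assoc prod.lift_snd_assoc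
  prod.comp_lift pullback.lift_fst pullback.lift_snd pullback.lift_fst_assoc pullback.lift_snd_assoc

/-- A lex primary doctrine on a category `C` with finite limits: a functor from `Cᵒᵖ` to the
category of inf-semilattices (with top element; morphisms preserve binary meets and top). -/
abbrev LexPrimaryDoctrine (C : Type u) [Category.{v} C] [HasFiniteLimits C] :
    Type (max u v (w + 1)) :=
  Cᵒᵖ ⥤ SemilatInfCat.{w}

namespace LexPrimaryDoctrine

variable {C : Type u} [Category.{v} C] [HasFiniteLimits C] (P : LexPrimaryDoctrine.{w} C)

/-- The fibre `P(A)`. -/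
abbrev Fib (A : C) : Type w := P.obj (op A)

/-- The reindexing map `P_f : P(B) → P(A)` along `f : A ⟶ B`. -/
def pull {A B : C} (f : A ⟶ B) : InfTopHom (P.Fib B) (P.Fib A) := P.map f.op

@[simp]
theorem pull_id {A : C} (α : P.Fib A) : P.pull (𝟙 A) α = α := by
  have h : P.map (𝟙 A).op = 𝟙 _ := P.map_id _
  unfold pull
  rw [h]
  rfl

theorem pull_comp {A B D : C} (f : A ⟶ B) (g : B ⟶ D) (α : P.Fib D) :
    P.pull (f ≫ g) α = P.pull f (P.pull g α) := by
  have h : P.map (f ≫ g).op = P.map g.op ≫ P.map f.op := P.map_comp _ _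
  unfold pull
  rw [h]
  rfl

theorem pull_mono {A B : C} (f : A ⟶ B) {α β : P.Fib B} (h : α ≤ β) :
    P.pull f α ≤ P.pull f β :=
  OrderHomClass.mono (P.pull f) h

/-! ### The category of points -/

/-- Objects of the category of points (Grothendieck construction) of `P`: pairs `(A, α)` with
`α ∈ P(A)`. -/
structure Points where
  base : C
  elt : P.Fib base

variable {P} in
/-- Morphisms `(A, α) ⟶ (B, β)` are the arrows `f : A ⟶ B` with `α ≤ P_f(β)`. -/
@[ext]
structure Points.Hom (X Y : P.Points) where
  hom : X.base ⟶ Y.base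
  le : X.elt ≤ P.pull hom Y.elt

instance : Category P.Points where
  Hom := Points.Hom
  id X := ⟨𝟙 _, by simp⟩
  comp f g := ⟨f.hom ≫ g.hom, by
    rw [pull_comp]
    exact f.le.trans (P.pull_mono _ g.le)⟩
  id_comp f := Points.Hom.ext (Category.id_comp f.hom)
  comp_id f := Points.Hom.ext (Category.comp_id f.hom)
  assoc f g h := Points.Hom.ext (Category.assoc f.hom g.hom h.hom)

namespace Points

variable {P}

@[ext]
theorem hom_ext {X Y : P.Points} {f g : X ⟶ Y} (h : f.hom = g.hom) : f = g := Hom.ext h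

@[simp] theorem id_hom (X : P.Points) : Hom.hom (𝟙 X) = 𝟙 X.base := rfl

@[simp] theorem comp_hom {X Y Z : P.Points} (f : X ⟶ Y) (g : Y ⟶ Z) :
    (f ≫ g).hom = f.hom ≫ g.hom := rfl

instance : HasTerminal P.Points :=
  IsTerminal.hasTerminal (X := (⟨⊤_ C, ⊤⟩ : P.Points))
    (IsTerminal.ofUniqueHom (fun X => ⟨terminal.from _, by simp⟩)
      (fun X m => hom_ext (Subsingleton.elim _ _)))

instance : HasPullbacks P.Points := by
  refine @hasPullbacks_of_hasLimit_cospan _ _ ?_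
  intro X Y Z f g
  let W : P.Points := ⟨pullback f.hom g.hom,
    P.pull (pullback.fst f.hom g.hom) X.elt ⊓ P.pull (pullback.snd f.hom g.hom) Y.elt⟩
  let p : W ⟶ X := ⟨pullback.fst f.hom g.hom, inf_le_left⟩
  let q : W ⟶ Y := ⟨pullback.snd f.hom g.hom, inf_le_right⟩
  have comm : p ≫ f = q ≫ g := hom_ext pullback.condition
  refine ⟨⟨⟨PullbackCone.mk p q comm, PullbackCone.IsLimit.mk comm
    (fun s => ⟨pullback.lift s.fst.hom s.snd.hom (congrArg Hom.hom s.condition), ?_⟩)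
    ?_ ?_ ?_⟩⟩⟩
  · change s.pt.elt ≤ P.pull _ (_ ⊓ _)
    rw [map_inf, ← pull_comp, ← pull_comp, pullback.lift_fst, pullback.lift_snd]
    exact le_inf (Hom.le s.fst) (Hom.le s.snd)
  · intro s
    exact hom_ext (pullback.lift_fst _ _ _)
  · intro s
    exact hom_ext (pullback.lift_snd _ _ _)
  · intro s m h1 h2
    refine hom_ext (pullback.hom_ext ?_ ?_)
    · exact (congrArg Hom.hom h1).trans (pullback.lift_fst _ _ _).symm
    · exact (congrArg Hom.hom h2).trans (pullback.lift_snd _ _ _).symm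

/-- The category of points has finite limits. -/
instance : HasFiniteLimits P.Points := hasFiniteLimits_of_hasTerminal_and_pullbacks

end Points

/-! ### Full existential doctrines -/

/-- `P` is full existential: every reindexing map `P_f` has a left adjoint `∃_f`, and these satisfy
the Beck-Chevalley condition (for all pullback squares) and Frobenius reciprocity. The maps `∃_f`
are uniquely determined by `P`, since the fibres are partially ordered. -/
class FullExistential where
  /-- the left adjoint `∃_f` -/
  ex {A B : C} (f : A ⟶ B) : P.Fib A → P.Fib B
  adj {A B : C} (f : A ⟶ B) : GaloisConnection (ex f) (P.pull f)
  beck_chevalley {W X Y Z : C} {p : W ⟶ X} {q : W ⟶ Y} {f : X ⟶ Z} {g : Y ⟶ Z}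
    (sq : IsPullback p q f g) (α : P.Fib X) : P.pull g (ex f α) = ex q (P.pull p α)
  frobenius {A B : C} (f : A ⟶ B) (α : P.Fib A) (β : P.Fib B) :
    ex f (α ⊓ P.pull f β) = ex f α ⊓ β

theorem le_of_forall_pull {A B : C} {φ ψ : P.Fib (A ⨯ B)}
    (h : ∀ (X : C) (a : X ⟶ A) (b : X ⟶ B),
      P.pull (prod.lift a b) φ ≤ P.pull (prod.lift a b) ψ) : φ ≤ ψ := by
  simpa [prod.lift_fst_snd] using h (A ⨯ B) prod.fst prod.snd

section Regular

variable [FullExistential P]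

/-- The left adjoint `∃_f : P(A) → P(B)` to reindexing along `f : A ⟶ B`. -/
def ex {A B : C} (f : A ⟶ B) (α : P.Fib A) : P.Fib B := FullExistential.ex f α

/-- The equality predicate `δ_A = ∃_{⟨id, id⟩}(⊤) ∈ P(A × A)`. -/
def delta (A : C) : P.Fib (A ⨯ A) := P.ex (prod.lift (𝟙 A) (𝟙 A)) ⊤

theorem le_pull_ex {X A B : C} (f : A ⟶ B) (a : X ⟶ A) (b : X ⟶ B) (h : a ≫ f = b)
    (α : P.Fib A) : P.pull a α ≤ P.pull b (P.ex f α) := by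
  subst h
  rw [pull_comp]
  exact P.pull_mono _ ((FullExistential.adj f).le_u_l α)

theorem pull_ex_inf_le {X A B : C} (f : A ⟶ B) (b : X ⟶ B) (α : P.Fib A) (ξ ζ : P.Fib X)
    (h : ∀ (Y : C) (r : Y ⟶ X) (a : Y ⟶ A), a ≫ f = r ≫ b →
      P.pull a α ⊓ P.pull r ξ ≤ P.pull r ζ) :
    P.pull b (P.ex f α) ⊓ ξ ≤ ζ := by
  unfold ex
  rw [FullExistential.beck_chevalley (IsPullback.of_hasPullback f b),
    ← FullExistential.frobenius]
  exact (FullExistential.adj _).l_le (h _ _ _ pullback.condition)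

theorem pull_ex_le {X A B : C} (f : A ⟶ B) (b : X ⟶ B) (α : P.Fib A) (ζ : P.Fib X)
    (h : ∀ (Y : C) (r : Y ⟶ X) (a : Y ⟶ A), a ≫ f = r ≫ b → P.pull a α ≤ P.pull r ζ) :
    P.pull b (P.ex f α) ≤ ζ := by
  rw [← inf_top_eq (P.pull b _)]
  exact P.pull_ex_inf_le f b α ⊤ ζ fun Y r a e => inf_le_left.trans (h Y r a e)

theorem top_le_delta {X A : C} (a : X ⟶ A) :
    ⊤ ≤ P.pull (prod.lift a a) (P.delta A) := by
  rw [← map_top (P.pull a)]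
  exact P.le_pull_ex _ _ _ (by ext <;> simp) ⊤

theorem delta_inf_le {X A : C} (a b : X ⟶ A) (ξ ζ : P.Fib X)
    (h : ∀ (Y : C) (r : Y ⟶ X), r ≫ a = r ≫ b → P.pull r ξ ≤ P.pull r ζ) :
    P.pull (prod.lift a b) (P.delta A) ⊓ ξ ≤ ζ := by
  refine P.pull_ex_inf_le _ _ _ _ _ fun Y r c e => inf_le_right.trans (h Y r ?_)
  have h1 := congrArg (· ≫ prod.fst) e
  have h2 := congrArg (· ≫ prod.snd) e
  simp only [Category.assoc, prod.lift_fst, prod.lift_snd, Category.comp_id] at h1 h2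
  exact h1.symm.trans h2

/-- Relational composition `∃_{⟨π₁, π₃⟩}(P_{⟨π₁, π₂⟩}(φ) ∧ P_{⟨π₂, π₃⟩}(ψ))`, where
`π₁, π₂, π₃` are the projections from `A × B × D`. -/
def relComp {A B D : C} (φ : P.Fib (A ⨯ B)) (ψ : P.Fib (B ⨯ D)) : P.Fib (A ⨯ D) :=
  P.ex (prod.lift prod.fst (prod.snd ≫ prod.snd) : A ⨯ (B ⨯ D) ⟶ A ⨯ D)
    (P.pull (prod.lift prod.fst (prod.snd ≫ prod.fst)) φ ⊓ P.pull prod.snd ψ)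

theorem le_relComp {X A B D : C} (φ : P.Fib (A ⨯ B)) (ψ : P.Fib (B ⨯ D))
    (a : X ⟶ A) (b : X ⟶ B) (d : X ⟶ D) :
    P.pull (prod.lift a b) φ ⊓ P.pull (prod.lift b d) ψ ≤
      P.pull (prod.lift a d) (P.relComp φ ψ) := by
  have h := P.le_pull_ex (prod.lift prod.fst (prod.snd ≫ prod.snd) : A ⨯ (B ⨯ D) ⟶ A ⨯ D)
    (prod.lift a (prod.lift b d)) (prod.lift a d) (by ext <;> simp)
    (P.pull (prod.lift prod.fst (prod.snd ≫ prod.fst)) φ ⊓ P.pull prod.snd ψ)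
  rw [map_inf, ← pull_comp, ← pull_comp] at h
  simpa [relComp] using h

theorem relComp_inf_le {X A B D : C} (φ : P.Fib (A ⨯ B)) (ψ : P.Fib (B ⨯ D))
    (a : X ⟶ A) (d : X ⟶ D) (ξ ζ : P.Fib X)
    (h : ∀ (Y : C) (r : Y ⟶ X) (b : Y ⟶ B),
      P.pull (prod.lift (r ≫ a) b) φ ⊓ P.pull (prod.lift b (r ≫ d)) ψ ⊓ P.pull r ξ ≤
        P.pull r ζ) :
    P.pull (prod.lift a d) (P.relComp φ ψ) ⊓ ξ ≤ ζ := by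
  refine P.pull_ex_inf_le _ _ _ _ _ fun Y r c e => ?_
  have h1 := congrArg (· ≫ prod.fst) e
  have h2 := congrArg (· ≫ prod.snd) e
  simp only [Category.assoc, prod.lift_fst, prod.lift_snd] at h1 h2
  have := h Y r (c ≫ prod.snd ≫ prod.fst)
  rw [← h1, ← h2] at this
  rw [map_inf, ← pull_comp, ← pull_comp]
  convert this using 4
  · ext
    all_goals simp
  · congr 1
    ext <;> simp

theorem relComp_le {X A B D : C} (φ : P.Fib (A ⨯ B)) (ψ : P.Fib (B ⨯ D))
    (a : X ⟶ A) (d : X ⟶ D) (ζ : P.Fib X)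
    (h : ∀ (Y : C) (r : Y ⟶ X) (b : Y ⟶ B),
      P.pull (prod.lift (r ≫ a) b) φ ⊓ P.pull (prod.lift b (r ≫ d)) ψ ≤ P.pull r ζ) :
    P.pull (prod.lift a d) (P.relComp φ ψ) ≤ ζ := by
  rw [← inf_top_eq (P.pull _ _)]
  exact P.relComp_inf_le φ ψ a d ⊤ ζ fun Y r b => inf_le_left.trans (h Y r b)

/-! ### The regular completion of a full existential doctrine -/

/-- Objects of the regular completion `Reg(P)`: pairs `(A, α)` with `α ∈ P(A)`. -/
structure Reg where
  base : C
  elt : P.Fib base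

variable {P} in
/-- Arrows `(A, α) ⟶ (B, β)` of `Reg(P)`: the elements `φ ∈ P(A × B)` which are total functional
relations from `α` to `β`. In `functional`, the projections are those from `A × B × B`. -/
@[ext]
structure Reg.Hom (X Y : P.Reg) where
  rel : P.Fib (X.base ⨯ Y.base)
  rel_le : rel ≤ P.pull prod.fst X.elt ⊓ P.pull prod.snd Y.elt
  total : X.elt ≤ P.ex prod.fst rel
  functional :
    P.pull (prod.lift prod.fst (prod.snd ≫ prod.fst) :
        X.base ⨯ (Y.base ⨯ Y.base) ⟶ X.base ⨯ Y.base) rel ⊓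
      P.pull (prod.lift prod.fst (prod.snd ≫ prod.snd)) rel ≤
    P.pull prod.snd (P.delta Y.base)

namespace Reg

variable {P}

theorem Hom.le_left {X Y : P.Reg} (φ : Hom X Y) {T : C} (a : T ⟶ X.base) (b : T ⟶ Y.base) :
    P.pull (prod.lift a b) φ.rel ≤ P.pull a X.elt := by
  have h := P.pull_mono (prod.lift a b) (φ.rel_le.trans inf_le_left)
  rwa [← pull_comp, prod.lift_fst] at h

theorem Hom.le_right {X Y : P.Reg} (φ : Hom X Y) {T : C} (a : T ⟶ X.base) (b : T ⟶ Y.base) :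
    P.pull (prod.lift a b) φ.rel ≤ P.pull b Y.elt := by
  have h := P.pull_mono (prod.lift a b) (φ.rel_le.trans inf_le_right)
  rwa [← pull_comp, prod.lift_snd] at h

theorem Hom.le_delta {X Y : P.Reg} (φ : Hom X Y) {T : C} (a : T ⟶ X.base)
    (b c : T ⟶ Y.base) :
    P.pull (prod.lift a b) φ.rel ⊓ P.pull (prod.lift a c) φ.rel ≤
      P.pull (prod.lift b c) (P.delta Y.base) := by
  have h := P.pull_mono (prod.lift a (prod.lift b c)) φ.functional
  rw [map_inf, ← pull_comp, ← pull_comp, ← pull_comp] at h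
  simpa using h

theorem Hom.elim {X Y : P.Reg} (φ : Hom X Y) {T : C} (a : T ⟶ X.base) (ξ ζ : P.Fib T)
    (hξ : ξ ≤ P.pull a X.elt)
    (h : ∀ (S : C) (r : S ⟶ T) (b : S ⟶ Y.base),
      P.pull (prod.lift (r ≫ a) b) φ.rel ⊓ P.pull r ξ ≤ P.pull r ζ) : ξ ≤ ζ := by
  refine (le_inf (hξ.trans (P.pull_mono a φ.total)) le_rfl).trans ?_
  refine P.pull_ex_inf_le _ _ _ _ _ fun S r c e => ?_
  have := h S r (c ≫ prod.snd)
  rw [← e] at this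
  convert this using 3
  congr 1
  ext <;> simp

theorem functional_of {A B : C} (φ : P.Fib (A ⨯ B))
    (h : ∀ (T : C) (a : T ⟶ A) (b c : T ⟶ B),
      P.pull (prod.lift a b) φ ⊓ P.pull (prod.lift a c) φ ≤
        P.pull (prod.lift b c) (P.delta B)) :
    P.pull (prod.lift prod.fst (prod.snd ≫ prod.fst) : A ⨯ (B ⨯ B) ⟶ A ⨯ B) φ ⊓
      P.pull (prod.lift prod.fst (prod.snd ≫ prod.snd)) φ ≤ P.pull prod.snd (P.delta B) := by
  have := h (A ⨯ (B ⨯ B)) prod.fst (prod.snd ≫ prod.fst) (prod.snd ≫ prod.snd)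
  convert this using 2
  congr 1
  ext <;> simp

/-- The identity on `(A, α)` is `P_{π₁}(α) ∧ δ_A`. -/
def idHom (X : P.Reg) : Hom X X where
  rel := P.pull prod.fst X.elt ⊓ P.delta X.base
  rel_le := by
    refine le_inf inf_le_left ?_
    rw [inf_comm]
    have := P.delta_inf_le (prod.fst : X.base ⨯ X.base ⟶ X.base) prod.snd
      (P.pull prod.fst X.elt) (P.pull prod.snd X.elt)
      (fun Y r e => by rw [← pull_comp, ← pull_comp, e])
    simpa [prod.lift_fst_snd] using this
  total := by
    have := P.le_pull_ex (prod.fst : X.base ⨯ X.base ⟶ X.base)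
      (prod.lift (𝟙 _) (𝟙 _)) (𝟙 _) (by simp) (P.pull prod.fst X.elt ⊓ P.delta X.base)
    rw [pull_id, map_inf, ← pull_comp, prod.lift_fst, pull_id] at this
    exact (le_inf le_rfl (le_top.trans (P.top_le_delta _))).trans this
  functional := by
    refine functional_of _ fun T a b c => ?_
    rw [map_inf, map_inf]
    refine (inf_le_inf inf_le_right inf_le_right).trans ?_
    refine P.delta_inf_le _ _ _ _ fun Y r e => ?_
    rw [← pull_comp, ← pull_comp, prod.comp_lift, prod.comp_lift, e]

/-- Composition of arrows of `Reg(P)` is relational composition. -/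
def compHom {X Y Z : P.Reg} (φ : Hom X Y) (ψ : Hom Y Z) : Hom X Z where
  rel := P.relComp φ.rel ψ.rel
  rel_le := by
    have := P.relComp_le φ.rel ψ.rel prod.fst prod.snd
      (P.pull prod.fst X.elt ⊓ P.pull prod.snd Z.elt) (fun T r b => by
        rw [map_inf, ← pull_comp, ← pull_comp]
        exact inf_le_inf (φ.le_left _ _) (ψ.le_right _ _))
    simpa [prod.lift_fst_snd] using this
  total := by
    refine φ.elim (𝟙 _) _ _ (by simp) fun S r b => ?_
    refine inf_le_left.trans ?_
    refine ψ.elim b _ _ (φ.le_right _ _) fun S' r' d => ?_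
    rw [inf_comm, ← pull_comp, prod.comp_lift]
    refine (P.le_relComp _ _ _ _ _).trans ?_
    rw [← pull_comp]
    exact P.le_pull_ex _ _ _ (by simp) _
  functional := by
    refine functional_of _ fun T a d d' => ?_
    refine P.relComp_inf_le _ _ _ _ _ _ fun S r b => ?_
    rw [inf_comm, ← pull_comp, prod.comp_lift]
    refine P.relComp_inf_le _ _ _ _ _ _ fun S' r' b' => ?_
    rw [map_inf, ← pull_comp, ← pull_comp, ← pull_comp, ← pull_comp]
    simp only [prod.comp_lift, ← Category.assoc]
    -- `φ(a, b')`, `ψ(b', d')`, `φ(a, b)` and `ψ(b, d)` give `δ(b, b')`, hence `δ(d, d')`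
    have key : ∀ (U : C) (a : U ⟶ X.base) (b b' : U ⟶ Y.base) (d d' : U ⟶ Z.base),
        (P.pull (prod.lift a b') φ.rel ⊓ P.pull (prod.lift b' d') ψ.rel) ⊓
          (P.pull (prod.lift a b) φ.rel ⊓ P.pull (prod.lift b d) ψ.rel) ≤
        P.pull (prod.lift d d') (P.delta Z.base) := by
      intro U a b b' d d'
      refine (le_inf ((le_inf (inf_le_right.trans inf_le_left)
        (inf_le_left.trans inf_le_left)).trans (φ.le_delta a b b')) (le_inf
          (inf_le_right.trans inf_le_right) (inf_le_left.trans inf_le_right))).trans ?_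
      refine P.delta_inf_le _ _ _ _ fun V s e => ?_
      rw [map_inf, ← pull_comp, ← pull_comp, ← pull_comp]
      simp only [prod.comp_lift]
      rw [← e]
      exact ψ.le_delta _ _ _
    exact key _ _ _ _ _ _

theorem idHom_comp {X Y : P.Reg} (φ : Hom X Y) : compHom (idHom X) φ = φ := by
  refine Hom.ext (le_antisymm ?_ ?_)
  · refine P.le_of_forall_pull fun T a b => P.relComp_le _ _ _ _ _ fun S r c => ?_
    simp only [idHom, map_inf]
    refine (inf_le_inf_right _ inf_le_right).trans ?_
    refine P.delta_inf_le _ _ _ _ fun V s e => ?_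
    rw [← pull_comp, ← pull_comp, ← pull_comp]
    simp only [prod.comp_lift]
    rw [← e]
    simp
  · refine P.le_of_forall_pull fun T a b => ?_
    refine le_trans ?_ (P.le_relComp _ _ a a b)
    refine le_inf ?_ le_rfl
    simp only [idHom, map_inf]
    refine le_inf ?_ (le_top.trans (P.top_le_delta a))
    rw [← pull_comp, prod.lift_fst]
    exact φ.le_left _ _

theorem comp_idHom {X Y : P.Reg} (φ : Hom X Y) : compHom φ (idHom Y) = φ := by
  refine Hom.ext (le_antisymm ?_ ?_)
  · refine P.le_of_forall_pull fun T a b => P.relComp_le _ _ _ _ _ fun S r c => ?_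
    simp only [idHom, map_inf]
    refine (inf_le_inf_left _ inf_le_right).trans ?_
    rw [inf_comm]
    refine P.delta_inf_le _ _ _ _ fun V s e => ?_
    rw [← pull_comp, ← pull_comp, ← pull_comp]
    simp only [prod.comp_lift]
    rw [e]
    simp
  · refine P.le_of_forall_pull fun T a b => ?_
    refine le_trans ?_ (P.le_relComp _ _ a b b)
    refine le_inf le_rfl ?_
    simp only [idHom, map_inf]
    refine le_inf ?_ (le_top.trans (P.top_le_delta b))
    rw [← pull_comp, prod.lift_fst]
    exact φ.le_right _ _

theorem compHom_assoc {X Y Z W : P.Reg} (φ : Hom X Y) (ψ : Hom Y Z) (χ : Hom Z W) :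
    compHom (compHom φ ψ) χ = compHom φ (compHom ψ χ) := by
  refine Hom.ext (le_antisymm ?_ ?_)
  · refine P.le_of_forall_pull fun T a d => P.relComp_le _ _ _ _ _ fun S r c => ?_
    refine P.relComp_inf_le _ _ _ _ _ _ fun S' r' b => ?_
    rw [← pull_comp, ← pull_comp, ← pull_comp, inf_assoc]
    simp only [prod.comp_lift, Category.assoc]
    exact (inf_le_inf_left _ (P.le_relComp _ _ _ _ _)).trans (P.le_relComp _ _ _ _ _)
  · refine P.le_of_forall_pull fun T a d => P.relComp_le _ _ _ _ _ fun S r b => ?_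
    rw [inf_comm]
    refine P.relComp_inf_le _ _ _ _ _ _ fun S' r' c => ?_
    rw [← pull_comp, ← pull_comp, ← pull_comp, inf_comm, ← inf_assoc]
    simp only [prod.comp_lift, Category.assoc]
    exact (inf_le_inf_right _ (P.le_relComp _ _ _ _ _)).trans (P.le_relComp _ _ _ _ _)

end Reg

/-- The regular completion `Reg(P)` of a full existential doctrine `P`. -/
instance : Category P.Reg where
  Hom := Reg.Hom
  id := Reg.idHom
  comp := Reg.compHom
  id_comp := Reg.idHom_comp
  comp_id := Reg.comp_idHom
  assoc := Reg.compHom_assoc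

end Regular

/-! ### The full existential completion -/

/-- Representatives of elements of the fibre over `A` of the full existential completion: pairs of
an arrow `f : B ⟶ A` and an element `α ∈ P(B)`. -/
structure ExRep (A : C) where
  dom : C
  hom : dom ⟶ A
  elt : P.Fib dom

/-- `(f : B ⟶ A, α) ≤ (g : D ⟶ A, β)` if there is `h : B ⟶ D` with `f = g ∘ h` and
`α ≤ P_h(β)`. -/
instance (A : C) : Preorder (P.ExRep A) where
  le x y := ∃ h : x.dom ⟶ y.dom, h ≫ y.hom = x.hom ∧ x.elt ≤ P.pull h y.elt
  le_refl x := ⟨𝟙 _, by simp, by simp⟩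
  le_trans := by
    rintro x y z ⟨h, h1, h2⟩ ⟨k, k1, k2⟩
    refine ⟨h ≫ k, by rw [Category.assoc, k1, h1], ?_⟩
    rw [pull_comp]
    exact h2.trans (P.pull_mono h k2)

variable {P} in
theorem ExRep.le_def {A : C} {x y : P.ExRep A} :
    x ≤ y ↔ ∃ h : x.dom ⟶ y.dom, h ≫ y.hom = x.hom ∧ x.elt ≤ P.pull h y.elt := Iff.rfl

/-- The fibre over `A` of the full existential completion: the poset reflection of the preorder
`ExRep A`. -/
abbrev ExFib (A : C) := Antisymmetrization (P.ExRep A) (· ≤ ·)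

namespace ExRep

variable {P}

/-- Reindexing by pullback. -/
abbrev pull {A B : C} (f : A ⟶ B) (x : P.ExRep B) : P.ExRep A :=
  ⟨pullback f x.hom, pullback.fst f x.hom, P.pull (pullback.snd f x.hom) x.elt⟩

/-- Binary meets, by pullback over `A`. -/
abbrev inf {A : C} (x y : P.ExRep A) : P.ExRep A :=
  ⟨pullback x.hom y.hom, pullback.fst x.hom y.hom ≫ x.hom,
    P.pull (pullback.fst x.hom y.hom) x.elt ⊓ P.pull (pullback.snd x.hom y.hom) y.elt⟩

/-- The top element `(id_A, ⊤)`. -/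
abbrev top (A : C) : P.ExRep A := ⟨A, 𝟙 A, ⊤⟩

/-- The left adjoint to reindexing, by postcomposition. -/
abbrev ex {A B : C} (f : A ⟶ B) (x : P.ExRep A) : P.ExRep B := ⟨x.dom, x.hom ≫ f, x.elt⟩

theorem inf_le_left {A : C} (x y : P.ExRep A) : inf x y ≤ x :=
  ⟨pullback.fst _ _, rfl, _root_.inf_le_left⟩

theorem inf_le_right {A : C} (x y : P.ExRep A) : inf x y ≤ y :=
  ⟨pullback.snd _ _, pullback.condition.symm, _root_.inf_le_right⟩

theorem le_inf {A : C} {x y z : P.ExRep A} (hy : z ≤ x) (hz : z ≤ y) : z ≤ inf x y := by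
  obtain ⟨h, h1, h2⟩ := hy
  obtain ⟨k, k1, k2⟩ := hz
  refine ⟨pullback.lift h k (h1.trans k1.symm), ?_, ?_⟩
  · simp [inf, h1]
  · simp only [inf, map_inf, ← pull_comp, pullback.lift_fst, pullback.lift_snd]
    exact _root_.le_inf h2 k2

theorem le_top {A : C} (x : P.ExRep A) : x ≤ top A := ⟨x.hom, by simp [top], by simp [top]⟩

theorem le_pull_iff {A B : C} (f : A ⟶ B) (x : P.ExRep A) (y : P.ExRep B) :
    x ≤ pull f y ↔
      ∃ h : x.dom ⟶ y.dom, h ≫ y.hom = x.hom ≫ f ∧ x.elt ≤ P.pull h y.elt := by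
  constructor
  · rintro ⟨h, h1, h2⟩
    refine ⟨h ≫ pullback.snd _ _, ?_, ?_⟩
    · rw [Category.assoc, ← pullback.condition, ← h1]
      simp [pull]
    · rw [pull_comp]
      exact h2
  · rintro ⟨h, h1, h2⟩
    refine ⟨pullback.lift x.hom h h1.symm, by simp [pull], ?_⟩
    simp only [pull, ← pull_comp, pullback.lift_snd]
    exact h2

theorem ex_le_iff {A B : C} (f : A ⟶ B) (x : P.ExRep A) (y : P.ExRep B) :
    ex f x ≤ y ↔ x ≤ pull f y := (le_pull_iff f x y).symm

theorem pull_mono {A B : C} (f : A ⟶ B) : Monotone (pull (P := P) f) := fun x y hxy => by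
  rw [← ex_le_iff]
  exact le_trans ((ex_le_iff f _ _).2 le_rfl) hxy

theorem ex_mono {A B : C} (f : A ⟶ B) : Monotone (ex (P := P) f) := fun x y hxy => by
  rw [ex_le_iff]
  exact le_trans hxy ((ex_le_iff f _ _).1 le_rfl)

end ExRep

instance (A : C) : SemilatticeInf (P.ExFib A) where
  inf := Quotient.map₂ ExRep.inf fun _ _ hx _ _ hy =>
    ⟨ExRep.le_inf ((ExRep.inf_le_left _ _).trans hx.1) ((ExRep.inf_le_right _ _).trans hy.1),
      ExRep.le_inf ((ExRep.inf_le_left _ _).trans hx.2) ((ExRep.inf_le_right _ _).trans hy.2)⟩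
  inf_le_left := by
    rintro ⟨x⟩ ⟨y⟩
    exact ExRep.inf_le_left x y
  inf_le_right := by
    rintro ⟨x⟩ ⟨y⟩
    exact ExRep.inf_le_right x y
  le_inf := by
    rintro ⟨x⟩ ⟨y⟩ ⟨z⟩ h1 h2
    exact ExRep.le_inf (x := y) (y := z) (z := x) h1 h2

instance (A : C) : OrderTop (P.ExFib A) where
  top := toAntisymmetrization _ (ExRep.top A)
  le_top := by
    rintro ⟨x⟩
    exact ExRep.le_top x

namespace ExFib

variable {P}

/-- The map on poset reflections induced by a monotone map. -/
def map {A B : C} (F : P.ExRep A → P.ExRep B) (hF : Monotone F) : P.ExFib A → P.ExFib B :=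
  Quotient.map F fun _ _ h => ⟨hF h.1, hF h.2⟩

/-- Reindexing `[g, β] ↦ [f^* g, P_{g^* f}(β)]`. -/
def pull {A B : C} (f : A ⟶ B) : InfTopHom (P.ExFib B) (P.ExFib A) where
  toFun := map (ExRep.pull f) (ExRep.pull_mono f)
  map_inf' := by
    rintro ⟨x⟩ ⟨y⟩
    refine le_antisymm (le_inf ?_ ?_) ?_
    · exact ExRep.pull_mono f (ExRep.inf_le_left x y)
    · exact ExRep.pull_mono f (ExRep.inf_le_right x y)
    · refine (ExRep.ex_le_iff f _ (ExRep.inf x y)).1 (ExRep.le_inf ?_ ?_)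
      · exact (ExRep.ex_le_iff f _ x).2 (ExRep.inf_le_left _ _)
      · exact (ExRep.ex_le_iff f _ y).2 (ExRep.inf_le_right _ _)
  map_top' := top_unique ((ExRep.ex_le_iff f (ExRep.top A) (ExRep.top B)).1 (ExRep.le_top _))

/-- The map `[g, α] ↦ [f ∘ g, α]`. -/
def ex {A B : C} (f : A ⟶ B) : P.ExFib A → P.ExFib B := map (ExRep.ex f) (ExRep.ex_mono f)

theorem gc {A B : C} (f : A ⟶ B) : GaloisConnection (ex (P := P) f) (pull f) := by
  rintro ⟨x⟩ ⟨y⟩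
  exact ExRep.ex_le_iff f x y

theorem ex_id (A : C) (x : P.ExFib A) : ex (𝟙 A) x = x := by
  obtain ⟨x⟩ := x
  change toAntisymmetrization _ (ExRep.ex (𝟙 A) x) = toAntisymmetrization _ x
  simp [ExRep.ex]

theorem ex_comp {A B D : C} (f : A ⟶ B) (g : B ⟶ D) (x : P.ExFib A) :
    ex (f ≫ g) x = ex g (ex f x) := by
  obtain ⟨x⟩ := x
  change toAntisymmetrization _ (ExRep.ex (f ≫ g) x) =
    toAntisymmetrization _ (ExRep.ex g (ExRep.ex f x))
  simp [ExRep.ex]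

end ExFib

/-- The full existential completion `P^∃` of a lex primary doctrine `P`. -/
def exCompletion : LexPrimaryDoctrine.{max u v w} C where
  obj A := SemilatInfCat.of (P.ExFib A.unop)
  map f := (ExFib.pull f.unop : InfTopHom _ _)
  map_id A := by
    refine InfTopHom.ext fun x => eq_of_forall_le_iff fun y => ?_
    change y ≤ ExFib.pull (𝟙 A.unop) x ↔ y ≤ x
    rw [← ExFib.gc (𝟙 A.unop) y x, ExFib.ex_id]
  map_comp {X Y Z} f g := by
    refine InfTopHom.ext fun x => eq_of_forall_le_iff fun y => ?_
    change y ≤ ExFib.pull (g.unop ≫ f.unop) x ↔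
      y ≤ ExFib.pull g.unop (ExFib.pull f.unop x)
    rw [← ExFib.gc, ← ExFib.gc, ← ExFib.gc, ExFib.ex_comp]

/-- The full existential completion is full existential. -/
instance : FullExistential P.exCompletion where
  ex f := ExFib.ex f
  adj f := ExFib.gc f
  beck_chevalley {W X Y Z p q f g} sq := by
    rintro ⟨x⟩
    refine le_antisymm ?_ ?_
    · change ExRep.pull g (ExRep.ex f x) ≤ ExRep.ex q (ExRep.pull p x)
      refine ⟨pullback.lift
        (sq.lift (pullback.snd _ _ ≫ x.hom) (pullback.fst g (x.hom ≫ f))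
          (by rw [pullback.condition, Category.assoc]))
        (pullback.snd g (x.hom ≫ f)) (by simp), ?_, ?_⟩
      · simp [ExRep.pull, ExRep.ex]
      · change P.pull _ _ ≤ P.pull _ (P.pull _ _)
        rw [← pull_comp, pullback.lift_snd]
    · refine (ExFib.gc (P := P) q _ _).2 ?_
      change ExRep.pull p x ≤ ExRep.pull q (ExRep.pull g (ExRep.ex f x))
      rw [← ExRep.ex_le_iff, ← ExRep.ex_le_iff]
      refine ⟨pullback.snd _ _, ?_, le_rfl⟩
      simp only [ExRep.ex, ExRep.pull, Category.assoc]
      rw [← pullback.condition_assoc, sq.w]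
  frobenius {A B} f := by
    rintro ⟨x⟩ ⟨y⟩
    refine le_antisymm (le_inf ?_ ?_) ?_
    · exact ExRep.ex_mono f (ExRep.inf_le_left x _)
    · exact (ExRep.ex_le_iff f _ y).2 (ExRep.inf_le_right _ _)
    · change ExRep.inf (ExRep.ex f x) y ≤ ExRep.ex f (ExRep.inf x (ExRep.pull f y))
      refine ⟨pullback.lift (pullback.fst (x.hom ≫ f) y.hom)
        (pullback.lift (pullback.fst (x.hom ≫ f) y.hom ≫ x.hom) (pullback.snd _ _)
          (by rw [Category.assoc, pullback.condition])) (by simp), ?_, ?_⟩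
      · simp [ExRep.ex, ExRep.inf]
      · change P.pull _ _ ⊓ P.pull _ _ ≤ P.pull _ (P.pull _ _ ⊓ P.pull _ (P.pull _ _))
        rw [map_inf, ← pull_comp, ← pull_comp, ← pull_comp, pullback.lift_fst]
        simp only [pullback.lift_snd]
        exact le_rfl

end LexPrimaryDoctrine

/-! ### The reg/lex completion of a category with finite limits -/

/-- Objects of the reg/lex completion of `D`: the arrows `f : X ⟶ Y` of `D`. -/
structure RegLex (D : Type u) [Category.{v} D] [HasFiniteLimits D] where
  dom : D
  cod : D
  hom : dom ⟶ cod

namespace RegLex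

variable {D : Type u} [Category.{v} D] [HasFiniteLimits D]

/-- Representatives of arrows from `f : X ⟶ Y` to `g : Z ⟶ W`: the arrows `l : X ⟶ Z` such that
`g ∘ l` coequalizes the kernel pair of `f`. -/
structure PreHom (f g : RegLex D) where
  hom : f.dom ⟶ g.dom
  w : pullback.fst f.hom f.hom ≫ hom ≫ g.hom = pullback.snd f.hom f.hom ≫ hom ≫ g.hom

theorem PreHom.apply {f g : RegLex D} (l : PreHom f g) {T : D} (a b : T ⟶ f.dom)
    (h : a ≫ f.hom = b ≫ f.hom) : a ≫ l.hom ≫ g.hom = b ≫ l.hom ≫ g.hom := by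
  have := congrArg (pullback.lift a b h ≫ ·) l.w
  simpa only [pullback.lift_fst_assoc, pullback.lift_snd_assoc] using this

/-- Two representatives `l`, `m` give the same arrow when `g ∘ l = g ∘ m`. -/
instance PreHom.setoid (f g : RegLex D) : Setoid (PreHom f g) where
  r l m := l.hom ≫ g.hom = m.hom ≫ g.hom
  iseqv := ⟨fun _ => rfl, fun h => h.symm, fun h k => h.trans k⟩

/-- Composition of representatives is composition in `D`. -/
def PreHom.comp {f g h : RegLex D} (l : PreHom f g) (m : PreHom g h) : PreHom f h where
  hom := l.hom ≫ m.hom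
  w := by
    have := m.apply (pullback.fst f.hom f.hom ≫ l.hom) (pullback.snd f.hom f.hom ≫ l.hom)
      (by simpa only [Category.assoc] using l.w)
    simpa only [Category.assoc] using this

/-- The reg/lex completion of a category with finite limits. -/
instance : Category (RegLex D) where
  Hom f g := _root_.Quotient (PreHom.setoid f g)
  id f := _root_.Quotient.mk _ ⟨𝟙 _, by simpa using pullback.condition⟩
  comp {f g h} := _root_.Quotient.map₂ PreHom.comp (by
    intro l l' hl m m' hm
    change (l.hom ≫ m.hom) ≫ h.hom = (l'.hom ≫ m'.hom) ≫ h.hom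
    rw [Category.assoc, Category.assoc, m.apply _ _ hl]
    exact congrArg (l'.hom ≫ ·) hm)
  id_comp := by
    rintro f g ⟨l⟩
    refine _root_.Quotient.sound ?_
    change (𝟙 _ ≫ l.hom) ≫ g.hom = l.hom ≫ g.hom
    rw [Category.id_comp]
  comp_id := by
    rintro f g ⟨l⟩
    refine _root_.Quotient.sound ?_
    change (l.hom ≫ 𝟙 _) ≫ g.hom = l.hom ≫ g.hom
    rw [Category.comp_id]
  assoc := by
    rintro f g h k ⟨l⟩ ⟨m⟩ ⟨n⟩
    refine _root_.Quotient.sound ?_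
    change ((l.hom ≫ m.hom) ≫ n.hom) ≫ k.hom = (l.hom ≫ m.hom ≫ n.hom) ≫ k.hom
    rw [Category.assoc l.hom]

end RegLex

end

noncomputable section

attribute [local simp] prod.lift_fst prod.lift_snd prod.comp_lift

namespace LexPrimaryDoctrine

variable {C : Type u} [Category.{v} C] [HasFiniteLimits C] {P : LexPrimaryDoctrine.{w} C}

/-! Read an object `f : (X, ξ) ⟶ (Y, υ)` of the reg/lex completion as the formal image of `f`; in
`Reg(P^∃)` this image is the pair `(Y, [f, ξ])`, and `l` becomes the graph `[⟨f, g ∘ l⟩, ξ]`. This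
assignment is an equivalence because the order of `P^∃` already consists of arrows of the category
of points: `[f, α] ≤ [g, β]` means that `f` factors through `g` by a morphism `(B, α) ⟶ (D, β)`
(`mk_le_mk`).

Existential statements in `P^∃` are therefore witnessed by arrows. Totality of a relation yields an
actual `l`, its functionality says that `g ∘ l` coequalizes the kernel pair of `f`, and equality of
graphs reduces to `g ∘ l = g ∘ m`. Since comparable functional relations coincide
(`Reg.Hom.eq_of_le`), one inequality always suffices. Every `[f, α]` has a representative, which
gives essential surjectivity. -/

/-- Comparable arrows of `Reg(P)` are equal. -/
theorem Reg.Hom.eq_of_le [FullExistential P] {X Y : P.Reg} {φ ψ : Reg.Hom X Y}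
    (h : φ.rel ≤ ψ.rel) : φ = ψ := by
  refine Reg.Hom.ext (le_antisymm h (P.le_of_forall_pull fun T a b => ?_))
  -- Given `ψ(a, b)`, totality of `φ` provides `c` with `φ(a, c)`, hence `ψ(a, c)`; functionality of
  -- `ψ` gives `c = b`, so `φ(a, b)`.
  refine φ.elim a _ _ (ψ.le_left a b) fun S r c => ?_
  rw [← pull_comp, ← pull_comp, prod.comp_lift]
  refine (le_inf ((inf_le_inf_right _ (P.pull_mono _ h)).trans (ψ.le_delta _ c (r ≫ b)))
    inf_le_left).trans ?_
  refine P.delta_inf_le _ _ _ _ fun V s e => ?_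
  rw [← pull_comp, ← pull_comp, prod.comp_lift, prod.comp_lift, e]

/-! ### Calculus of representatives in `P^∃` -/

namespace exCompletion

/-- The element of `P^∃(A)` represented by an arrow `f : B ⟶ A` and an element `α ∈ P(B)`. -/
def mk {A B : C} (f : B ⟶ A) (α : P.Fib B) : P.exCompletion.Fib A :=
  toAntisymmetrization (· ≤ ·) (⟨B, f, α⟩ : P.ExRep A)

theorem exists_mk_eq {A : C} (φ : P.exCompletion.Fib A) :
    ∃ (B : C) (f : B ⟶ A) (α : P.Fib B), mk f α = φ := by
  obtain ⟨⟨B, f, α⟩⟩ := φ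
  exact ⟨B, f, α, rfl⟩

/-- The bridge between the two sides: the data on the right are exactly a morphism `(B, α) ⟶ (D, β)`
of points lying over `A`. -/
theorem mk_le_mk {A B D : C} {f : B ⟶ A} {α : P.Fib B} {g : D ⟶ A} {β : P.Fib D} :
    mk f α ≤ mk g β ↔ ∃ h : B ⟶ D, h ≫ g = f ∧ α ≤ P.pull h β := Iff.rfl

/-- Adjunction `∃_u ⊣ P_u`, with `∃_u` being postcomposition; it removes every pullback from the
computations below. -/
theorem mk_le_pull {A B D : C} {f : B ⟶ A} {α : P.Fib B} (u : A ⟶ D)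
    {φ : P.exCompletion.Fib D} :
    mk f α ≤ P.exCompletion.pull u φ ↔ mk (f ≫ u) α ≤ φ :=
  (ExFib.gc u (mk f α) φ).symm

theorem ex_mk {A B D : C} (f : B ⟶ A) (α : P.Fib B) (u : A ⟶ D) :
    P.exCompletion.ex u (mk f α) = mk (f ≫ u) α := rfl

theorem le_of_forall_mk_le {A : C} {φ ψ : P.exCompletion.Fib A}
    (h : ∀ (B : C) (f : B ⟶ A) (α : P.Fib B), mk f α ≤ φ → mk f α ≤ ψ) : φ ≤ ψ := by
  obtain ⟨B, f, α, rfl⟩ := exists_mk_eq φ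
  exact h B f α le_rfl

/-- `δ_A` is represented by the diagonal with element `⊤`, so lying below it means factoring through
the diagonal, with no constraint on `α`. -/
theorem mk_le_delta {A B : C} {f : B ⟶ A ⨯ A} {α : P.Fib B} :
    mk f α ≤ P.exCompletion.delta A ↔ f ≫ prod.fst = f ≫ prod.snd := by
  change mk f α ≤ mk (𝟙 A ≫ prod.lift (𝟙 A) (𝟙 A)) ⊤ ↔ _
  rw [mk_le_mk]
  constructor
  · rintro ⟨h, rfl, -⟩
    simp
  · intro h
    refine ⟨f ≫ prod.fst, ?_, by simp⟩
    ext
    · simp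
    · simpa using h

end exCompletion

/-! ### The image functor -/

open exCompletion

/-- The object `(Y, [f, ξ])` of `Reg(P^∃)` given by an arrow `f : (X, ξ) ⟶ (Y, υ)` of the
category of points. -/
abbrev imageObj (f : RegLex P.Points) : P.exCompletion.Reg := ⟨f.cod.base, mk f.hom.hom f.dom.elt⟩

/-- The functional relation `[⟨f, g ∘ l⟩, ξ]` given by an arrow `l` from `f` to `g`. -/
def imageHom {f g : RegLex P.Points} (l : RegLex.PreHom f g) :
    Reg.Hom (imageObj f) (imageObj g) where
  rel := mk (prod.lift f.hom.hom (l.hom.hom ≫ g.hom.hom)) f.dom.elt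
  rel_le := by
    refine le_inf ((mk_le_pull _).2 ?_) ((mk_le_pull _).2 ?_)
    · exact mk_le_mk.2 ⟨𝟙 _, by simp, by simp⟩
    · exact mk_le_mk.2 ⟨l.hom.hom, by simp, Points.Hom.le l.hom⟩
  total := by
    rw [ex_mk]
    exact mk_le_mk.2 ⟨𝟙 _, by simp, by simp⟩
  functional := by
    refine le_of_forall_mk_le fun B u α h => ?_
    obtain ⟨r, hr, hr'⟩ := mk_le_mk.1 ((mk_le_pull _).1 (h.trans inf_le_left))
    obtain ⟨s, hs, hs'⟩ := mk_le_mk.1 ((mk_le_pull _).1 (h.trans inf_le_right))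
    rw [mk_le_pull, mk_le_delta]
    have r1 := congrArg (· ≫ prod.fst) hr
    have r2 := congrArg (· ≫ prod.snd) hr
    have s1 := congrArg (· ≫ prod.fst) hs
    have s2 := congrArg (· ≫ prod.snd) hs
    simp only [Category.assoc, prod.lift_fst, prod.lift_snd] at r1 r2 s1 s2
    -- The witnesses `r` and `s` are morphisms of points from `(B, α)` equalized by `f`, so they
    -- factor through its kernel pair and `g ∘ l` identifies them.
    have := l.apply (T := ⟨B, α⟩) ⟨r, hr'⟩ ⟨s, hs'⟩ (Points.hom_ext (r1.trans s1.symm))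
    have := congrArg Points.Hom.hom this
    simp only [Category.assoc]
    exact r2.symm.trans (this.trans s2)

/-- Only one inequality is needed, by `Reg.Hom.eq_of_le`; the intermediate element of the relational
composite is `g ∘ l`. -/
theorem imageHom_comp {f g h : RegLex P.Points} (l : RegLex.PreHom f g)
    (m : RegLex.PreHom g h) :
    imageHom (l.comp m) = Reg.compHom (imageHom l) (imageHom m) := by
  refine Reg.Hom.eq_of_le ?_
  have e : mk (𝟙 f.dom.base) f.dom.elt ≤ P.exCompletion.pull
      (prod.lift f.hom.hom (l.hom.hom ≫ m.hom.hom ≫ h.hom.hom))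
      (P.exCompletion.relComp (imageHom l).rel (imageHom m).rel) := by
    refine le_trans (le_inf ?_ ?_) (P.exCompletion.le_relComp _ _ _
      (l.hom.hom ≫ g.hom.hom) _)
    · exact (mk_le_pull _).2 (mk_le_mk.2 ⟨𝟙 _, rfl, by simp⟩)
    · exact (mk_le_pull _).2 (mk_le_mk.2 ⟨l.hom.hom, by simp, Points.Hom.le l.hom⟩)
  have e' := (mk_le_pull _).1 e
  rw [Category.id_comp, ← Category.assoc] at e'
  exact e'

/-- The functor sending an arrow `f : (X, ξ) ⟶ (Y, υ)` of the category of points to its image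
`(Y, [f, ξ])`. -/
def imageFunctor (P : LexPrimaryDoctrine.{w} C) : RegLex P.Points ⥤ P.exCompletion.Reg where
  obj := imageObj
  map {f g} := _root_.Quotient.lift imageHom fun l m (h : l.hom ≫ g.hom = m.hom ≫ g.hom) => by
    have h' : l.hom.hom ≫ g.hom.hom = m.hom.hom ≫ g.hom.hom := congrArg Points.Hom.hom h
    -- The graph depends on `l` only through `g ∘ l`, which is all that the equivalence class
    -- retains.
    refine Reg.Hom.ext ?_
    simp only [imageHom, h']
  map_id f := by
    refine Reg.Hom.eq_of_le (le_inf ?_ ?_)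
    · exact (imageHom _).rel_le.trans inf_le_left
    · exact mk_le_delta.2 (by simp)
  map_comp := by
    rintro f g h ⟨l⟩ ⟨m⟩
    exact imageHom_comp l m

/-! ### The image functor is an equivalence -/

instance : (imageFunctor P).Faithful where
  map_injective {f g} := by
    rintro ⟨l⟩ ⟨m⟩ h
    have h : (imageHom l).rel ≤ (imageHom m).rel := (congrArg Reg.Hom.rel h).le
    -- Here `f ∘ r = f` and `g ∘ m ∘ r = g ∘ l`. Compatibility of `m` with the kernel pair, applied
    -- to `r` and the identity, gives `g ∘ m ∘ r = g ∘ m`.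
    obtain ⟨r, hr, hr'⟩ := mk_le_mk.1 h
    have h1 := congrArg (· ≫ prod.fst) hr
    have h2 := congrArg (· ≫ prod.snd) hr
    simp only [Category.assoc, prod.lift_fst, prod.lift_snd] at h1 h2
    have key := m.apply ⟨r, hr'⟩ (𝟙 _) (Points.hom_ext (h1.trans (Category.id_comp _).symm))
    refine _root_.Quotient.sound (Points.hom_ext ?_)
    have key := congrArg Points.Hom.hom key
    rw [Category.id_comp] at key
    exact h2.symm.trans key

instance : (imageFunctor P).Full where
  map_surjective {f g} φ := by
    change Reg.Hom (imageObj f) (imageObj g) at φ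
    obtain ⟨T, t, τ, ht⟩ := exists_mk_eq φ.rel
    have h1 := φ.total
    have h2 := φ.rel_le.trans inf_le_right
    rw [← ht] at h1 h2
    rw [ex_mk] at h1
    -- Totality lifts `f` through the first component of `t`; the bound of `φ` by its target lifts
    -- the second component through `g`. The composite of the lifts is the required `l`.
    obtain ⟨r, hr, hr'⟩ := mk_le_mk.1 h1
    obtain ⟨s, hs, hs'⟩ := mk_le_mk.1 ((mk_le_pull _).1 h2)
    let l : f.dom ⟶ g.dom := ⟨r ≫ s, by
      rw [pull_comp]
      exact hr'.trans (P.pull_mono r hs')⟩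
    have hl : l.hom ≫ g.hom.hom = r ≫ t ≫ prod.snd := by
      exact (Category.assoc r s g.hom.hom).trans (congrArg (r ≫ ·) hs)
    have hle : mk (prod.lift f.hom.hom (l.hom ≫ g.hom.hom)) f.dom.elt ≤ φ.rel := by
      rw [← ht]
      refine mk_le_mk.2 ⟨r, ?_, hr'⟩
      rw [hl, ← hr]
      ext <;> simp
    have w : pullback.fst f.hom f.hom ≫ l ≫ g.hom = pullback.snd f.hom f.hom ≫ l ≫ g.hom := by
      refine Points.hom_ext ?_
      set p := pullback.fst f.hom f.hom
      set q := pullback.snd f.hom f.hom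
      have hpq : p.hom ≫ f.hom.hom = q.hom ≫ f.hom.hom :=
        congrArg Points.Hom.hom (pullback.condition (f := f.hom) (g := f.hom))
      -- At the generic point of the kernel pair, `φ` relates `f ∘ k` to `g ∘ l ∘ k` for both
      -- projections `k`. As `f ∘ p = f ∘ q`, functionality of `φ` forces the two values to agree.
      have hp : ∀ k : pullback f.hom f.hom ⟶ f.dom,
          mk (𝟙 _) (pullback f.hom f.hom).elt ≤ P.exCompletion.pull
            (prod.lift (k.hom ≫ f.hom.hom) (k.hom ≫ l.hom ≫ g.hom.hom)) φ.rel := fun k =>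
        (mk_le_pull _).2 (le_trans (mk_le_mk.2 ⟨k.hom, by simp, Points.Hom.le k⟩) hle)
      have hp1 := hp p
      rw [hpq] at hp1
      have := mk_le_delta.1 ((mk_le_pull _).1 ((le_inf hp1 (hp q)).trans (φ.le_delta _ _ _)))
      simpa using this
    exact ⟨_root_.Quotient.mk _ ⟨l, w⟩, Reg.Hom.eq_of_le hle⟩

instance : (imageFunctor P).EssSurj where
  mem_essImage := by
    rintro ⟨A, φ⟩
    obtain ⟨B, f, α, rfl⟩ := exists_mk_eq φ
    -- With `⊤` on the codomain any `f` is a morphism of points. The image ignores that element, so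
    -- it is the given object on the nose.
    exact ⟨⟨⟨B, α⟩, ⟨A, ⊤⟩, ⟨f, by simp⟩⟩, ⟨Iso.refl _⟩⟩

end LexPrimaryDoctrine

end

theorem mainTheorem9 {C : Type u} [Category.{v} C] [HasFiniteLimits C]
    (P : LexPrimaryDoctrine.{w} C) :
    Nonempty (P.exCompletion.Reg ≌ RegLex P.Points) := by
  have : P.imageFunctor.IsEquivalence := {}
  exact ⟨P.imageFunctor.asEquivalence.symm⟩
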